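/- Let $\mathbb{D}=\{z\in\mathbb{C}:|z|<1\}$ and let $dA$ be the area measure. For $0<p<\infty$ write $\|g\|_p=\left(\frac1\pi\iint_{\mathbb{D}}|g|^p\,dA\right)^{1/p}$, and let $A^p$ be the Bergman space of all analytic functions $f$ in $\mathbb{D}$ with $\|f\|_p<\infty$. Suppose that $f\in A^p$ with $1<p<\infty$. Then there is a sequence of polynomials $P_n$ with integer coefficients and $\deg P_n\le n$ such that $$\lim_{n\to\infty}\|f-P_n\|_p=0$$ if and only if $f$ has a power series expansion about $z=0$ in $\mathbb{D}$ with integer coefficients. The latter condition is equivalent to $f^{(k)}(0)/k!\in\mathbb{Z}$ for all integers $k\ge 0$. -/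

import Mathlib

open scoped Nat

/-- The open unit disk `𝔻` in the complex plane. -/
def unitDisk : Set ℂ := Metric.ball (0 : ℂ) 1

/-- The Bergman norm `‖f‖_p = ((1/π) ∬_𝔻 |f|^p dA)^{1/p}`, where `dA` is the area measure
(Lebesgue measure on `ℂ`). It only depends on the values of `f` in the disk. -/
noncomputable def bergmanNorm (p : ℝ) (f : ℂ → ℂ) : ℝ :=
  ((1 / Real.pi) * ∫ z in unitDisk, ‖f z‖ ^ p) ^ (1 / p)

/-- `f` belongs to the Bergman space `A^p`: it is analytic in the unit disk and
`|f|^p` has a finite area integral over the disk. -/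
structure MemBergman (p : ℝ) (f : ℂ → ℂ) : Prop where
  analytic : DifferentiableOn ℂ f unitDisk
  integrable : MeasureTheory.IntegrableOn (fun z => ‖f z‖ ^ p) unitDisk

/-- The disk function `f` has a power series expansion about `0` with integer coefficients. -/
def HasIntegerPowerSeries (f : ℂ → ℂ) : Prop :=
  ∃ a : ℕ → ℤ, ∀ z ∈ unitDisk, HasSum (fun k : ℕ => (a k : ℂ) * z ^ k) (f z)

/-!
The statement reduces to one analytic fact: for `1 < p < ∞` the Taylor sections of a function in
`A^p` converge to it in `A^p`. If the Taylor coefficients are integers, the sections themselves are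
integer polynomials of the right degree. Conversely, the same estimate bounds each Taylor
coefficient by the `A^p` norm, so if integer polynomials converge to `f`, their coefficients
converge to those of `f`, and limits of integers are integers.

The convergence of Taylor sections comes from M. Riesz's theorem on circles. For `F` entire with
`F 0` real, `∫ |F|^p ≤ C ∫ |Re F|^p` over the unit circle (`exists_riesz_inequality`). This follows
from the sub-mean value property of `Ψ ∘ F` for a smooth subharmonic `Ψ` on `ℂ` with
`|w|^p ≤ C |Re w|^p - Ψ w`, up to a regularization by `ε` and, when `p > 2`, an application of
Young's inequality. With `u = Re w` one can take `Ψ = 2/(p-1) |u|^p - |w|^p` when `1 < p ≤ 2`, since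
then `Δ|w|^p = p² |w|^(p-2)` is dominated by `2/(p-1)` times `Δ|u|^p = p(p-1) |u|^(p-2)`, and
`Ψ = (p²/2) u² |w|^(p-2) - |w|^p` when `p ≥ 2`.

Multiplying a polynomial by `e^{-imt}` splits it on the circle into an analytic part `A`, a constant
`c` and an antianalytic part, the conjugate of an analytic `B`. Riesz's inequality applied to
`Re c + A + B` and `Im c - i(A - B)`, whose real parts are the real and imaginary parts of the given
function, recovers `B`, hence the section of degree `< m`, with a bound independent of `m`
(`exists_partialSum_bound_circle`). On each circle of radius `r < 1` the Taylor remainder tends to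
zero uniformly, and its `p`-th power mean is at most a constant times that of `f`, so dominated
convergence in `r` gives convergence over the disk (`tendsto_lintegral_remainder_disk`).
-/

open Complex MeasureTheory
open scoped ENNReal

/-! ### Smooth subharmonic functions on the plane -/

/-- A `C²` function on the plane with nonnegative Laplacian. The Laplacian is tested as the trace of
the Hessian on every orthogonal pair `h, ih` of equal length, not only on `1, i`; this form passes
directly to compositions with holomorphic functions. -/
structure SmoothSubharmonic (G : ℂ → ℝ) : Prop where
  contDiff : ContDiff ℝ 2 G
  laplacian_nonneg : ∀ w h : ℂ,
    0 ≤ fderiv ℝ (fderiv ℝ G) w h h + fderiv ℝ (fderiv ℝ G) w (I * h) (I * h)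

theorem hasDerivAt_intervalIntegral_of_continuous {a b : ℝ} {K K' : ℝ → ℝ → ℝ}
    (hK : ∀ r, Continuous (K r)) (hK' : Continuous (Function.uncurry K'))
    (hd : ∀ r t, HasDerivAt (fun r => K r t) (K' r t) r) (r : ℝ) :
    HasDerivAt (fun r => ∫ t in a..b, K r t) (∫ t in a..b, K' r t) r := by
  obtain ⟨C, hC⟩ := ((isCompact_Icc (a := r - 1) (b := r + 1)).prod
    (isCompact_uIcc (a := a) (b := b))).exists_bound_of_continuousOn hK'.continuousOn
  refine (intervalIntegral.hasDerivAt_integral_of_dominated_loc_of_deriv_le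
    (s := Set.Icc (r - 1) (r + 1)) (bound := fun _ => C)
    (Icc_mem_nhds (by linarith) (by linarith))
    (Filter.Eventually.of_forall fun x => (hK x).aestronglyMeasurable)
    ((hK r).intervalIntegrable _ _)
    (Continuous.aestronglyMeasurable (by fun_prop)) ?_ (by simp) ?_).2
  · refine Filter.Eventually.of_forall fun t ht x hx => ?_
    exact hC (x, t) ⟨hx, Set.uIoc_subset_uIcc ht⟩
  · exact Filter.Eventually.of_forall fun t _ x _ => hd x t

theorem fderiv_restrictScalars_apply {F : ℂ → ℂ} (hF : Differentiable ℂ F) (z h : ℂ) :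
    fderiv ℝ F z h = deriv F z * h := by
  rw [((hF z).hasFDerivAt.restrictScalars ℝ).fderiv]
  simp [mul_comm]

theorem SmoothSubharmonic.hasFDerivAt_fderiv {G : ℂ → ℝ} (hG : SmoothSubharmonic G) (w : ℂ) :
    HasFDerivAt (fderiv ℝ G) (fderiv ℝ (fderiv ℝ G) w) w :=
  ((hG.contDiff.fderiv_right (m := 1) (by norm_num)).differentiable (by norm_num) w).hasFDerivAt

theorem SmoothSubharmonic.continuous_fderiv_fderiv {G : ℂ → ℝ} (hG : SmoothSubharmonic G) :
    Continuous (fderiv ℝ (fderiv ℝ G)) :=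
  (hG.contDiff.fderiv_right (m := 1) (by norm_num)).continuous_fderiv (by norm_num)

/-- The terms containing `F''` cancel between the directions `h` and `ih`; what remains is the
Hessian of `G` on the pair `F' h, i F' h`. -/
theorem SmoothSubharmonic.comp_holomorphic {G : ℂ → ℝ} (hG : SmoothSubharmonic G)
    {F : ℂ → ℂ} (hF : Differentiable ℂ F) : SmoothSubharmonic (fun z => G (F z)) := by
  have hFR : ContDiff ℝ 2 F := (hF.contDiff (n := 2)).restrict_scalars ℝ
  have hc : ContDiff ℝ 2 (fun z => G (F z)) := hG.contDiff.comp hFR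
  have h1 : ∀ h, (fun z => fderiv ℝ (fun z => G (F z)) z h)
      = fun z => fderiv ℝ G (F z) (deriv F z * h) := by
    intro h
    funext z
    have hd : HasFDerivAt (fun z => G (F z)) ((fderiv ℝ G (F z)).comp (fderiv ℝ F z)) z :=
      (hG.contDiff.differentiable (by norm_num) (F z)).hasFDerivAt.comp z
        (hFR.differentiable (by norm_num) z).hasFDerivAt
    rw [hd.fderiv, ContinuousLinearMap.comp_apply, fderiv_restrictScalars_apply hF]
  have hF' : Differentiable ℂ (deriv F) := hF.deriv
  have h2 : ∀ z h k, fderiv ℝ (fderiv ℝ (fun z => G (F z))) z k h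
      = fderiv ℝ (fderiv ℝ G) (F z) (deriv F z * k) (deriv F z * h)
        + fderiv ℝ G (F z) (deriv (deriv F) z * k * h) := by
    intro z h k
    have e1 : HasFDerivAt (fun z => fderiv ℝ (fun z => G (F z)) z h)
        ((ContinuousLinearMap.apply ℝ ℝ h).comp (fderiv ℝ (fderiv ℝ (fun z => G (F z))) z)) z :=
      (ContinuousLinearMap.apply ℝ ℝ h).hasFDerivAt.comp z
        ((hc.fderiv_right (m := 1) (by norm_num)).differentiable (by norm_num) z).hasFDerivAt
    have e2 := ((hG.hasFDerivAt_fderiv (F z)).comp z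
      (hFR.differentiable (by norm_num) z).hasFDerivAt).clm_apply
      (((hF'.restrictScalars ℝ z).hasFDerivAt).mul_const h)
    rw [h1 h] at e1
    have := congrArg (fun L => L k) (e1.unique e2)
    simp only [ContinuousLinearMap.comp_apply, ContinuousLinearMap.apply_apply] at this
    rw [this]
    simp [fderiv_restrictScalars_apply hF, fderiv_restrictScalars_apply hF', mul_comm,
      add_comm]
  refine ⟨hc, fun z h => ?_⟩
  rw [h2, h2]
  have h3 : deriv (deriv F) z * (I * h) * (I * h) = -(deriv (deriv F) z * h * h) := by
    linear_combination (deriv (deriv F) z * h * h) * I_mul_I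
  have h4 : deriv F z * (I * h) = I * (deriv F z * h) := by ring
  rw [h3, h4, map_neg]
  linarith [hG.laplacian_nonneg (F z) (deriv F z * h)]

/-- Sub-mean value inequality on the unit circle. With `M r` the integral of `G` over the circle of
radius `r`, polar coordinates give `r (r M')' ≥ 0`, since the angular part of the Laplacian
integrates to zero over a period. Hence `r M' ≥ 0`, so `M` increases from `2π G 0`. -/
theorem SmoothSubharmonic.le_integral_circleMap {G : ℂ → ℝ} (hG : SmoothSubharmonic G) :
    2 * Real.pi * G 0 ≤ ∫ t in (-Real.pi)..Real.pi, G (circleMap 0 1 t) := by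
  set e : ℝ → ℂ := circleMap 0 1 with he
  have hec : Continuous e := continuous_circleMap 0 1
  have hed : ∀ t, HasDerivAt e (I * e t) t := fun t => by
    simpa [he, mul_comm] using hasDerivAt_circleMap 0 1 t
  have hd1 : Continuous (fderiv ℝ G) := hG.contDiff.continuous_fderiv (by norm_num)
  have hd2 := hG.continuous_fderiv_fderiv
  have hdiff : Differentiable ℝ G := hG.contDiff.differentiable (by norm_num)
  have hGc : Continuous G := hG.contDiff.continuous
  have hline : ∀ r t : ℝ, HasDerivAt (fun r : ℝ => (r : ℂ) * e t) (e t) r := fun r t => by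
    simpa using (ofRealCLM.hasDerivAt (x := r)).mul_const (e t)
  have hcirc : ∀ r t : ℝ, HasDerivAt (fun t : ℝ => (r : ℂ) * e t) (I * (r * e t)) t := fun r t => by
    exact ((hed t).const_mul (r : ℂ)).congr_deriv (by ring)
  set M : ℝ → ℝ := fun r => ∫ t in (-Real.pi)..Real.pi, G (r * e t) with hM
  -- `N r = r M' r`
  set N : ℝ → ℝ := fun r => ∫ t in (-Real.pi)..Real.pi, fderiv ℝ G (r * e t) (r * e t) with hN
  have hM' : ∀ r : ℝ, HasDerivAt M (∫ t in (-Real.pi)..Real.pi, fderiv ℝ G (r * e t) (e t)) r := by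
    refine hasDerivAt_intervalIntegral_of_continuous (fun r => by fun_prop) ?_ fun r t => ?_
    · simp only [Function.uncurry_def]; fun_prop
    · exact (hdiff (r * e t)).hasFDerivAt.comp_hasDerivAt r (hline r t)
  have hN' : ∀ r : ℝ, HasDerivAt N (∫ t in (-Real.pi)..Real.pi,
      (fderiv ℝ (fderiv ℝ G) (r * e t) (e t) (r * e t) + fderiv ℝ G (r * e t) (e t))) r := by
    refine hasDerivAt_intervalIntegral_of_continuous (fun r => by fun_prop) ?_ fun r t => ?_
    · simp only [Function.uncurry_def]; fun_prop
    · have h1 : HasDerivAt (fun r : ℝ => fderiv ℝ G (r * e t))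
          (fderiv ℝ (fderiv ℝ G) (r * e t) (e t)) r :=
        (hG.hasFDerivAt_fderiv (r * e t)).comp_hasDerivAt r (hline r t)
      exact h1.clm_apply (hline r t)
  have hMN : ∀ r : ℝ, r * (∫ t in (-Real.pi)..Real.pi, fderiv ℝ G (r * e t) (e t)) = N r := by
    intro r
    rw [hN, ← intervalIntegral.integral_const_mul]
    congr 1; funext t
    rw [← real_smul, map_smul, real_smul, smul_eq_mul]
  have hper : ∀ r : ℝ, ∫ t in (-Real.pi)..Real.pi,
      (fderiv ℝ (fderiv ℝ G) (r * e t) (I * (r * e t)) (I * (r * e t))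
        - fderiv ℝ G (r * e t) (r * e t)) = 0 := by
    intro r
    rw [intervalIntegral.integral_eq_sub_of_hasDerivAt
      (f := fun t => fderiv ℝ G (r * e t) (I * (r * e t)))]
    · have : e Real.pi = e (-Real.pi) := by simp [he, circleMap, exp_neg, exp_pi_mul_I]
      rw [this, sub_self]
    · intro t _
      have h1 : HasDerivAt (fun t : ℝ => fderiv ℝ G (r * e t))
          (fderiv ℝ (fderiv ℝ G) (r * e t) (I * (r * e t))) t :=
        (hG.hasFDerivAt_fderiv (r * e t)).comp_hasDerivAt t (hcirc r t)
      refine (h1.clm_apply ((hcirc r t).const_mul I)).congr_deriv ?_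
      have : I * (I * (r * e t)) = -(r * e t) := by linear_combination (r * e t) * I_mul_I
      rw [this, map_neg, sub_eq_add_neg]
    · exact Continuous.intervalIntegrable (by fun_prop) _ _
  have hNnn : ∀ r : ℝ, 0 < r → 0 ≤ deriv N r := by
    intro r hr
    rw [(hN' r).deriv]
    refine nonneg_of_mul_nonneg_right (a := r) ?_ hr
    rw [← intervalIntegral.integral_const_mul, ← add_zero (intervalIntegral _ _ _ _)]
    conv_rhs => rw [← hper r]
    rw [← intervalIntegral.integral_add (Continuous.intervalIntegrable (by fun_prop) _ _)
        (Continuous.intervalIntegrable (by fun_prop) _ _)]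
    refine intervalIntegral.integral_nonneg (by linarith [Real.pi_pos]) fun t _ => ?_
    have h1 : fderiv ℝ (fderiv ℝ G) (r * e t) (r * e t) (r * e t)
        = r * fderiv ℝ (fderiv ℝ G) (r * e t) (e t) (r * e t) := by
      conv_lhs => enter [1, 2]; rw [← real_smul]
      rw [map_smul]; rfl
    have h2 : fderiv ℝ G (r * e t) (r * e t) = r * fderiv ℝ G (r * e t) (e t) := by
      conv_lhs => enter [2]; rw [← real_smul]
      rw [map_smul]; rfl
    have := hG.laplacian_nonneg (r * e t) (r * e t)
    linarith
  have hN0 : N 0 = 0 := by simp [hN]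
  have hNmono : MonotoneOn N (Set.Ici 0) :=
    monotoneOn_of_deriv_nonneg (convex_Ici 0)
      (fun r _ => (hN' r).continuousAt.continuousWithinAt)
      (fun r _ => (hN' r).differentiableAt.differentiableWithinAt)
      (fun r hr => hNnn r (by simpa using hr))
  have hMmono : MonotoneOn M (Set.Ici 0) := by
    refine monotoneOn_of_deriv_nonneg (convex_Ici 0)
      (fun r _ => (hM' r).continuousAt.continuousWithinAt)
      (fun r _ => (hM' r).differentiableAt.differentiableWithinAt) fun r hr => ?_
    have hr : 0 < r := by simpa using hr
    rw [(hM' r).deriv]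
    refine nonneg_of_mul_nonneg_right (a := r) ?_ hr
    rw [hMN, ← hN0]
    exact hNmono (by simp) hr.le hr.le
  have := hMmono (Set.mem_Ici.2 le_rfl) (Set.mem_Ici.2 zero_le_one) zero_le_one
  simp only [hM, ofReal_zero, zero_mul, intervalIntegral.integral_const, ofReal_one, one_mul,
    smul_eq_mul] at this
  linarith

/-! ### Subharmonic comparison functions for the `p`-th power -/

/-- The Hessian on the diagonal is the second derivative along a line. -/
theorem fderiv_fderiv_eq_of_hasDerivAt_line {G : ℂ → ℝ} (hG : ContDiff ℝ 2 G) {w h : ℂ}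
    {g₁ : ℝ → ℝ} {g₂ : ℝ} (h₁ : ∀ x : ℝ, HasDerivAt (fun x : ℝ => G (w + x * h)) (g₁ x) x)
    (h₂ : HasDerivAt g₁ g₂ 0) : fderiv ℝ (fderiv ℝ G) w h h = g₂ := by
  have hline : ∀ x : ℝ, HasDerivAt (fun x : ℝ => w + x * h) h x := fun x => by
    simpa using ((ofRealCLM.hasDerivAt (x := x)).mul_const h).const_add w
  have e₁ : g₁ = fun x : ℝ => fderiv ℝ G (w + x * h) h := by
    funext x
    exact (h₁ x).unique
      ((hG.differentiable (by norm_num) (w + x * h)).hasFDerivAt.comp_hasDerivAt x (hline x))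
  have hd := ((hG.fderiv_right (m := 1) (by norm_num)).differentiable (by norm_num)
    (w + (0 : ℝ) * h)).hasFDerivAt
  have e₂ : HasDerivAt (fun x : ℝ => fderiv ℝ G (w + x * h))
      (fderiv ℝ (fderiv ℝ G) (w + (0 : ℝ) * h) h) 0 := hd.comp_hasDerivAt 0 (hline 0)
  have e₃ := e₂.clm_apply (hasDerivAt_const (0 : ℝ) h)
  rw [e₁] at h₂
  simpa using (h₂.unique e₃).symm

/-- The second derivative of `σ ^ q` at `0`, computed from its first derivative
`q σ ^ (q - 1) σ'`. -/
theorem hasDerivAt_rpow_mul_deriv {σ σ' : ℝ → ℝ} {l q : ℝ} (hpos : ∀ x, 0 < σ x)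
    (h₁ : ∀ x, HasDerivAt σ (σ' x) x) (h₂ : HasDerivAt σ' l 0) :
    HasDerivAt (fun x => q * σ x ^ (q - 1) * σ' x)
      (q * σ 0 ^ (q - 2) * ((q - 1) * σ' 0 ^ 2 + σ 0 * l)) 0 := by
  refine ((((h₁ 0).rpow_const (p := q - 1) (Or.inl (hpos 0).ne')).const_mul q).mul h₂).congr_deriv
    ?_
  rw [show q - 1 - 1 = q - 2 by ring, show q - 1 = (q - 2) + 1 by ring,
    Real.rpow_add_one (hpos 0).ne']
  ring

theorem contDiff_normSq_add_rpow {ε : ℝ} (hε : 0 < ε) (q : ℝ) :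
    ContDiff ℝ 2 (fun w : ℂ => (w.re ^ 2 + w.im ^ 2 + ε) ^ q) :=
  ((by exact ((reCLM.contDiff.pow 2).add (imCLM.contDiff.pow 2)).add contDiff_const :
    ContDiff ℝ 2 (fun w : ℂ => w.re ^ 2 + w.im ^ 2 + ε))).rpow_const_of_ne
    fun w => by positivity

theorem contDiff_re_sq_add_rpow {ε : ℝ} (hε : 0 < ε) (q : ℝ) :
    ContDiff ℝ 2 (fun w : ℂ => (w.re ^ 2 + ε) ^ q) :=
  ((by exact (reCLM.contDiff.pow 2).add contDiff_const :
    ContDiff ℝ 2 (fun w : ℂ => w.re ^ 2 + ε))).rpow_const_of_ne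
    fun w => by positivity

theorem hasDerivAt_re_sq_add (a c ε x : ℝ) :
    HasDerivAt (fun x : ℝ => (a + x * c) ^ 2 + ε) (2 * (a + x * c) * c) x := by
  refine (((((hasDerivAt_id x).mul_const c).const_add a).pow 2).add_const ε).congr_deriv ?_
  simp

theorem hasDerivAt_normSq_add (a b c d ε x : ℝ) :
    HasDerivAt (fun x : ℝ => (a + x * c) ^ 2 + (b + x * d) ^ 2 + ε)
      (2 * (a + x * c) * c + 2 * (b + x * d) * d) x := by
  refine (((((hasDerivAt_id x).mul_const c).const_add a).pow 2).add
    ((((hasDerivAt_id x).mul_const d).const_add b).pow 2) |>.add_const ε).congr_deriv ?_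
  simp

theorem hasDerivAt_two_mul_affine_mul (a c : ℝ) :
    HasDerivAt (fun x : ℝ => 2 * (a + x * c) * c) (2 * c ^ 2) 0 := by
  refine (((((hasDerivAt_id (0 : ℝ)).mul_const c).const_add a).const_mul 2).mul_const c).congr_deriv
    (by ring)

/-- For `1 < p ≤ 2` the Laplacian of `(u² + ε)^(p/2)` is at least `p (p - 1) (u² + ε)^(p/2 - 1)` and
that of `(|w|² + ε)^(p/2)` is at most `2 p (|w|² + ε)^(p/2 - 1)`; since `p/2 - 1 ≤ 0` and
`u² ≤ |w|²`, the factor `2 / (p - 1)` makes the difference subharmonic. -/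
theorem smoothSubharmonic_small_exponent {p ε : ℝ} (hp : 1 < p) (hp2 : p ≤ 2) (hε : 0 < ε) :
    SmoothSubharmonic (fun w : ℂ => 2 / (p - 1) * (w.re ^ 2 + ε) ^ (p / 2)
      - (w.re ^ 2 + w.im ^ 2 + ε) ^ (p / 2)) := by
  have hcd : ContDiff ℝ 2 (fun w : ℂ => 2 / (p - 1) * (w.re ^ 2 + ε) ^ (p / 2)
      - (w.re ^ 2 + w.im ^ 2 + ε) ^ (p / 2)) :=
    (contDiff_const.mul (contDiff_re_sq_add_rpow hε _)).sub (contDiff_normSq_add_rpow hε _)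
  have key : ∀ w h : ℂ, fderiv ℝ (fderiv ℝ (fun w : ℂ => 2 / (p - 1) * (w.re ^ 2 + ε) ^ (p / 2)
      - (w.re ^ 2 + w.im ^ 2 + ε) ^ (p / 2))) w h h
      = 2 / (p - 1) * (p / 2 * (w.re ^ 2 + ε) ^ (p / 2 - 2) *
          ((p / 2 - 1) * (2 * w.re * h.re) ^ 2 + (w.re ^ 2 + ε) * (2 * h.re ^ 2)))
        - p / 2 * (w.re ^ 2 + w.im ^ 2 + ε) ^ (p / 2 - 2) *
          ((p / 2 - 1) * (2 * w.re * h.re + 2 * w.im * h.im) ^ 2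
            + (w.re ^ 2 + w.im ^ 2 + ε) * (2 * h.re ^ 2 + 2 * h.im ^ 2)) := by
    intro w h
    have pos1 : ∀ x : ℝ, 0 < (w.re + x * h.re) ^ 2 + ε := fun x => by positivity
    have pos2 : ∀ x : ℝ, 0 < (w.re + x * h.re) ^ 2 + (w.im + x * h.im) ^ 2 + ε :=
      fun x => by positivity
    have d1 := hasDerivAt_re_sq_add w.re h.re ε
    have d2 := hasDerivAt_normSq_add w.re w.im h.re h.im ε
    refine fderiv_fderiv_eq_of_hasDerivAt_line hcd (g₁ := fun x =>
      2 / (p - 1) * (p / 2 * ((w.re + x * h.re) ^ 2 + ε) ^ (p / 2 - 1)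
          * (2 * (w.re + x * h.re) * h.re))
        - p / 2 * ((w.re + x * h.re) ^ 2 + (w.im + x * h.im) ^ 2 + ε) ^ (p / 2 - 1)
          * (2 * (w.re + x * h.re) * h.re + 2 * (w.im + x * h.im) * h.im)) (fun x => ?_) ?_
    · have := (((d1 x).rpow_const (p := p / 2) (Or.inl (pos1 x).ne')).const_mul (2 / (p - 1))).sub
        ((d2 x).rpow_const (p := p / 2) (Or.inl (pos2 x).ne'))
      simp only [add_re, add_im, re_ofReal_mul, im_ofReal_mul]
      exact this.congr_deriv (by ring)
    · have := ((hasDerivAt_rpow_mul_deriv (q := p / 2) pos1 d1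
        (hasDerivAt_two_mul_affine_mul _ _)).const_mul (2 / (p - 1))).sub
        (hasDerivAt_rpow_mul_deriv (q := p / 2) pos2 d2
        ((hasDerivAt_two_mul_affine_mul _ _).add (hasDerivAt_two_mul_affine_mul _ _)))
      exact this.congr_deriv (by simp)
  refine ⟨hcd, fun w h => ?_⟩
  rw [key, key]
  simp only [I_mul_re, I_mul_im]
  generalize w.re = a
  generalize w.im = b
  generalize h.re = c
  generalize h.im = d
  have ht : 0 < a ^ 2 + ε := by positivity
  have hs : 0 < a ^ 2 + b ^ 2 + ε := by positivity
  have hT : (a ^ 2 + ε) ^ (p / 2 - 1) = (a ^ 2 + ε) ^ (p / 2 - 2) * (a ^ 2 + ε) := by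
    rw [← Real.rpow_add_one ht.ne']; ring_nf
  have hS : (a ^ 2 + b ^ 2 + ε) ^ (p / 2 - 1)
      = (a ^ 2 + b ^ 2 + ε) ^ (p / 2 - 2) * (a ^ 2 + b ^ 2 + ε) := by
    rw [← Real.rpow_add_one hs.ne']; ring_nf
  have hle : (a ^ 2 + b ^ 2 + ε) ^ (p / 2 - 1) ≤ (a ^ 2 + ε) ^ (p / 2 - 1) :=
    Real.rpow_le_rpow_of_nonpos ht (by nlinarith) (by linarith)
  rw [hT, hS] at hle
  have hT0 : 0 < (a ^ 2 + ε) ^ (p / 2 - 2) := Real.rpow_pos_of_pos ht _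
  have hS0 : 0 < (a ^ 2 + b ^ 2 + ε) ^ (p / 2 - 2) := Real.rpow_pos_of_pos hs _
  generalize (a ^ 2 + ε) ^ (p / 2 - 2) = T at *
  generalize (a ^ 2 + b ^ 2 + ε) ^ (p / 2 - 2) = S at *
  have hp1 : 0 < p - 1 := by linarith
  have hL : 0 ≤ c ^ 2 + d ^ 2 := by positivity
  have h1 : (p - 1) * (2 * (T * (a ^ 2 + ε)) * (c ^ 2 + d ^ 2)) ≤
      T * ((p - 2) * (2 * a ^ 2) + 2 * (a ^ 2 + ε)) * (c ^ 2 + d ^ 2) := by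
    have : 0 ≤ T * (c ^ 2 + d ^ 2) * (ε * (2 - p)) := by
      have : 0 ≤ 2 - p := by linarith
      positivity
    linarith
  have h2 : S * ((p - 2) * (2 * (a ^ 2 + b ^ 2)) + 4 * (a ^ 2 + b ^ 2 + ε)) * (c ^ 2 + d ^ 2) ≤
      4 * (S * (a ^ 2 + b ^ 2 + ε)) * (c ^ 2 + d ^ 2) := by
    have : 0 ≤ S * (c ^ 2 + d ^ 2) * ((2 - p) * (2 * (a ^ 2 + b ^ 2))) := by
      have : 0 ≤ 2 - p := by linarith
      positivity
    linarith
  have h3 := mul_le_mul_of_nonneg_right hle hL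
  have h4 : 4 * (T * (a ^ 2 + ε)) * (c ^ 2 + d ^ 2) ≤
      2 / (p - 1) * (T * ((p - 2) * (2 * a ^ 2) + 2 * (a ^ 2 + ε)) * (c ^ 2 + d ^ 2)) := by
    calc 4 * (T * (a ^ 2 + ε)) * (c ^ 2 + d ^ 2)
        = 2 / (p - 1) * ((p - 1) * (2 * (T * (a ^ 2 + ε)) * (c ^ 2 + d ^ 2))) := by
          field_simp; ring
      _ ≤ _ := by gcongr
  have h5 := mul_le_mul_of_nonneg_left (h2.trans ((by linarith : _ ≤ _).trans h4))
    (by positivity : 0 ≤ p / 2)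
  linear_combination h5

/-- Here `p = 2 (q + 1) ≥ 2`. With `s = |w|² + ε`, the Laplacian of `(u² + ε) s^q` is at least
`2 s^q`, from the second derivative of `u²` alone, while that of `s^(q+1)` is at most
`4 (q + 1)² s^q`. -/
theorem smoothSubharmonic_large_exponent {q ε : ℝ} (hq : 0 ≤ q) (hε : 0 < ε) :
    SmoothSubharmonic (fun w : ℂ =>
      2 * (q + 1) ^ 2 * ((w.re ^ 2 + ε) * (w.re ^ 2 + w.im ^ 2 + ε) ^ q)
        - (w.re ^ 2 + w.im ^ 2 + ε) ^ (q + 1)) := by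
  have hcd : ContDiff ℝ 2 (fun w : ℂ =>
      2 * (q + 1) ^ 2 * ((w.re ^ 2 + ε) * (w.re ^ 2 + w.im ^ 2 + ε) ^ q)
        - (w.re ^ 2 + w.im ^ 2 + ε) ^ (q + 1)) :=
    (contDiff_const.mul (((reCLM.contDiff.pow 2).add contDiff_const).mul
      (contDiff_normSq_add_rpow hε _))).sub (contDiff_normSq_add_rpow hε _)
  have key : ∀ w h : ℂ, fderiv ℝ (fderiv ℝ (fun w : ℂ =>
      2 * (q + 1) ^ 2 * ((w.re ^ 2 + ε) * (w.re ^ 2 + w.im ^ 2 + ε) ^ q)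
        - (w.re ^ 2 + w.im ^ 2 + ε) ^ (q + 1))) w h h
      = 2 * (q + 1) ^ 2 * (2 * h.re ^ 2 * (w.re ^ 2 + w.im ^ 2 + ε) ^ q
          + 2 * (2 * w.re * h.re * (q * (w.re ^ 2 + w.im ^ 2 + ε) ^ (q - 1)
              * (2 * w.re * h.re + 2 * w.im * h.im)))
          + (w.re ^ 2 + ε) * (q * (w.re ^ 2 + w.im ^ 2 + ε) ^ (q - 2)
              * ((q - 1) * (2 * w.re * h.re + 2 * w.im * h.im) ^ 2
            + (w.re ^ 2 + w.im ^ 2 + ε) * (2 * h.re ^ 2 + 2 * h.im ^ 2))))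
        - (q + 1) * (w.re ^ 2 + w.im ^ 2 + ε) ^ (q + 1 - 2) *
          ((q + 1 - 1) * (2 * w.re * h.re + 2 * w.im * h.im) ^ 2
            + (w.re ^ 2 + w.im ^ 2 + ε) * (2 * h.re ^ 2 + 2 * h.im ^ 2)) := by
    intro w h
    have pos2 : ∀ x : ℝ, 0 < (w.re + x * h.re) ^ 2 + (w.im + x * h.im) ^ 2 + ε :=
      fun x => by positivity
    have d1 := hasDerivAt_re_sq_add w.re h.re ε
    have d2 := hasDerivAt_normSq_add w.re w.im h.re h.im ε
    have d2q := fun (q x : ℝ) => (d2 x).rpow_const (p := q) (Or.inl (pos2 x).ne')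
    have dd2 := (hasDerivAt_two_mul_affine_mul w.re h.re).add
      (hasDerivAt_two_mul_affine_mul w.im h.im)
    refine fderiv_fderiv_eq_of_hasDerivAt_line hcd (g₁ := fun x =>
      2 * (q + 1) ^ 2 * (2 * (w.re + x * h.re) * h.re
            * ((w.re + x * h.re) ^ 2 + (w.im + x * h.im) ^ 2 + ε) ^ q
          + ((w.re + x * h.re) ^ 2 + ε)
            * (q * ((w.re + x * h.re) ^ 2 + (w.im + x * h.im) ^ 2 + ε) ^ (q - 1)
          * (2 * (w.re + x * h.re) * h.re + 2 * (w.im + x * h.im) * h.im)))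
        - (q + 1) * ((w.re + x * h.re) ^ 2 + (w.im + x * h.im) ^ 2 + ε) ^ (q + 1 - 1)
          * (2 * (w.re + x * h.re) * h.re + 2 * (w.im + x * h.im) * h.im)) (fun x => ?_) ?_
    · have := (((d1 x).mul (d2q q x)).const_mul (2 * (q + 1) ^ 2)).sub (d2q (q + 1) x)
      simp only [add_re, add_im, re_ofReal_mul, im_ofReal_mul]
      exact this.congr_deriv (by ring)
    · have := ((((hasDerivAt_two_mul_affine_mul w.re h.re).mul (d2q q 0)).add
        ((d1 0).mul (hasDerivAt_rpow_mul_deriv (q := q) pos2 d2 dd2))).const_mul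
          (2 * (q + 1) ^ 2)).sub (hasDerivAt_rpow_mul_deriv (q := q + 1) pos2 d2 dd2)
      refine this.congr_deriv ?_
      simp only [zero_mul, add_zero]
      ring
  refine ⟨hcd, fun w h => ?_⟩
  rw [key, key]
  simp only [I_mul_re, I_mul_im]
  generalize w.re = a
  generalize w.im = b
  generalize h.re = c
  generalize h.im = d
  have hs : 0 < a ^ 2 + b ^ 2 + ε := by positivity
  have hS1 : (a ^ 2 + b ^ 2 + ε) ^ (q - 1)
      = (a ^ 2 + b ^ 2 + ε) ^ (q - 2) * (a ^ 2 + b ^ 2 + ε) := by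
    rw [← Real.rpow_add_one hs.ne']; ring_nf
  have hS2 : (a ^ 2 + b ^ 2 + ε) ^ q
      = (a ^ 2 + b ^ 2 + ε) ^ (q - 2) * (a ^ 2 + b ^ 2 + ε) ^ 2 := by
    rw [← Real.rpow_add_natCast hs.ne']; norm_num
  rw [show q + 1 - 2 = q - 1 by ring, hS1, hS2]
  have hS0 : 0 < (a ^ 2 + b ^ 2 + ε) ^ (q - 2) := Real.rpow_pos_of_pos hs _
  generalize (a ^ 2 + b ^ 2 + ε) ^ (q - 2) = S at *
  have e : 0 ≤ (c ^ 2 + d ^ 2) * S * (2 * (q + 1) ^ 2 * (8 * a ^ 2 * q * (a ^ 2 + b ^ 2 + ε)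
      + 4 * (a ^ 2 + ε) * q * (q * (a ^ 2 + b ^ 2) + ε))
      + 4 * (q + 1) * (a ^ 2 + b ^ 2 + ε) * (q * ε)) := by positivity
  linear_combination e

/-! ### Riesz's inequality on the unit circle -/

theorem norm_rpow_eq_sq_rpow (w : ℂ) (p : ℝ) : ‖w‖ ^ p = (w.re ^ 2 + w.im ^ 2) ^ (p / 2) := by
  rw [← Complex.sq_norm_sub_sq_re w, add_sub_cancel, ← Real.rpow_natCast_mul (norm_nonneg w)]
  congr 1; push_cast; ring

/-- Riesz's inequality with `|Re F|` replaced by `((Re F)² + ε)^(1/2)`; the constant does not depend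
on `ε`. The term with `F 0` is kept because it later controls a single Taylor coefficient. -/
theorem exists_riesz_inequality_regularized {p : ℝ} (hp : 1 < p) :
    ∃ C : ℝ, 0 ≤ C ∧ ∀ F : ℂ → ℂ, Differentiable ℂ F → (F 0).im = 0 → ∀ ε > 0,
      2 * Real.pi * ‖F 0‖ ^ p + ∫ t in (-Real.pi)..Real.pi, ‖F (circleMap 0 1 t)‖ ^ p
        ≤ C * ∫ t in (-Real.pi)..Real.pi, ((F (circleMap 0 1 t)).re ^ 2 + ε) ^ (p / 2) := by
  have hpi := Real.pi_pos
  have hp0 : 0 ≤ p / 2 := by linarith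
  have hint : ∀ F : ℂ → ℂ, Differentiable ℂ F → ∀ ε > 0,
      ∫ t in (-Real.pi)..Real.pi, ‖F (circleMap 0 1 t)‖ ^ p
        ≤ ∫ t in (-Real.pi)..Real.pi,
          ((F (circleMap 0 1 t)).re ^ 2 + (F (circleMap 0 1 t)).im ^ 2 + ε) ^ (p / 2) := by
    intro F hF ε hε
    have hc : Continuous fun t => F (circleMap 0 1 t) :=
      hF.continuous.comp (continuous_circleMap 0 1)
    refine intervalIntegral.integral_mono_on (by linarith)
      (Continuous.intervalIntegrable ?_ _ _) (Continuous.intervalIntegrable ?_ _ _) fun t _ => ?_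
    · exact hc.norm.rpow_const fun _ => Or.inr (by linarith)
    · exact ((((continuous_re.comp hc).pow 2).add ((continuous_im.comp hc).pow 2)).add
        continuous_const).rpow_const fun _ => Or.inr hp0
    · rw [norm_rpow_eq_sq_rpow]
      exact Real.rpow_le_rpow (by positivity) (by linarith) hp0
  have h0 : ∀ w : ℂ, w.im = 0 → ∀ ε > 0, ‖w‖ ^ p ≤ (w.re ^ 2 + ε) ^ (p / 2) := by
    intro w hw ε hε
    rw [norm_rpow_eq_sq_rpow, hw]
    exact Real.rpow_le_rpow (by positivity) (by linarith) hp0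
  rcases le_total p 2 with hp2 | hp2
  · have hp1 : 0 < p - 1 := by linarith
    have hK : 2 ≤ 2 / (p - 1) := by rw [le_div_iff₀ hp1]; linarith
    refine ⟨2 / (p - 1), by linarith, fun F hF hF0 ε hε => ?_⟩
    have hc : Continuous fun t => F (circleMap 0 1 t) :=
      hF.continuous.comp (continuous_circleMap 0 1)
    have key := ((smoothSubharmonic_small_exponent hp hp2 hε).comp_holomorphic hF
      ).le_integral_circleMap
    rw [intervalIntegral.integral_sub, intervalIntegral.integral_const_mul, hF0] at key
    · have h1 := h0 (F 0) hF0 ε hε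
      have h2 : 0 ≤ ((F 0).re ^ 2 + ε) ^ (p / 2) := by positivity
      have h3 : ‖F 0‖ ^ p ≤ 2 / (p - 1) * ((F 0).re ^ 2 + ε) ^ (p / 2)
          - ((F 0).re ^ 2 + 0 ^ 2 + ε) ^ (p / 2) := by
        rw [show (F 0).re ^ 2 + 0 ^ 2 + ε = (F 0).re ^ 2 + ε by ring]
        nlinarith
      have h4 := mul_le_mul_of_nonneg_left h3 (by linarith : 0 ≤ 2 * Real.pi)
      linarith [hint F hF ε hε]
    · refine (Continuous.const_mul ?_ _).intervalIntegrable _ _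
      exact (((continuous_re.comp hc).pow 2).add
        continuous_const).rpow_const fun _ => Or.inr hp0
    · refine Continuous.intervalIntegrable ?_ _ _
      exact ((((continuous_re.comp hc).pow 2).add ((continuous_im.comp hc).pow 2)).add
        continuous_const).rpow_const fun _ => Or.inr hp0
  · obtain ⟨q, rfl⟩ : ∃ q, p = 2 * (q + 1) := ⟨p / 2 - 1, by ring⟩
    have hq : 0 ≤ q := by linarith
    rw [show 2 * (q + 1) / 2 = q + 1 by ring] at *
    set K : ℝ := 2 * (q + 1) ^ 2 with hK
    have hK2 : 2 ≤ K := by nlinarith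
    refine ⟨2 * (K * (2 * K) ^ q), by positivity, fun F hF hF0 ε hε => ?_⟩
    have hc : Continuous fun t => F (circleMap 0 1 t) :=
      hF.continuous.comp (continuous_circleMap 0 1)
    have hcs : ∀ r : ℝ, 0 ≤ r → Continuous fun t =>
        ((F (circleMap 0 1 t)).re ^ 2 + (F (circleMap 0 1 t)).im ^ 2 + ε) ^ r := fun r hr =>
      ((((continuous_re.comp hc).pow 2).add ((continuous_im.comp hc).pow 2)).add
        continuous_const).rpow_const fun _ => Or.inr hr
    have hcu : Continuous fun t => (F (circleMap 0 1 t)).re ^ 2 + ε :=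
      ((continuous_re.comp hc).pow 2).add continuous_const
    have hcu' : Continuous fun t => ((F (circleMap 0 1 t)).re ^ 2 + ε) ^ (q + 1) :=
      hcu.rpow_const fun _ => Or.inr hp0
    have key := ((smoothSubharmonic_large_exponent hq hε).comp_holomorphic hF
      ).le_integral_circleMap
    rw [← hK, intervalIntegral.integral_sub, intervalIntegral.integral_const_mul, hF0] at key
    rotate_left
    · exact ((hcu.mul (hcs q hq)).const_mul _).intervalIntegrable _ _
    · exact (hcs _ hp0).intervalIntegrable _ _
    -- Young's inequality: `K X Y ^ q ≤ Y ^ (q + 1) / 2 + K (2 K) ^ q X ^ (q + 1)`, where the first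
    -- term can be absorbed on the left-hand side.
    have hyoung : K * ∫ t in (-Real.pi)..Real.pi, (((F (circleMap 0 1 t)).re ^ 2 + ε) *
          ((F (circleMap 0 1 t)).re ^ 2 + (F (circleMap 0 1 t)).im ^ 2 + ε) ^ q)
        ≤ 1 / 2 * (∫ t in (-Real.pi)..Real.pi,
          ((F (circleMap 0 1 t)).re ^ 2 + (F (circleMap 0 1 t)).im ^ 2 + ε) ^ (q + 1))
        + K * (2 * K) ^ q * ∫ t in (-Real.pi)..Real.pi,
          ((F (circleMap 0 1 t)).re ^ 2 + ε) ^ (q + 1) := by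
      rw [← intervalIntegral.integral_const_mul, ← intervalIntegral.integral_const_mul,
        ← intervalIntegral.integral_const_mul, ← intervalIntegral.integral_add
          (((hcs _ hp0).const_mul _).intervalIntegrable _ _)
          ((hcu'.const_mul _).intervalIntegrable _ _)]
      refine intervalIntegral.integral_mono_on (by linarith)
        (((hcu.mul (hcs q hq)).const_mul _).intervalIntegrable _ _)
        ((((hcs _ hp0).const_mul _).add (hcu'.const_mul _)).intervalIntegrable _ _) fun t _ => ?_
      generalize F (circleMap 0 1 t) = w
      have hX : 0 < w.re ^ 2 + ε := by positivity
      have hY : 0 < w.re ^ 2 + w.im ^ 2 + ε := by positivity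
      generalize w.re ^ 2 + ε = X at *
      generalize w.re ^ 2 + w.im ^ 2 + ε = Y at *
      rw [Real.rpow_add_one hX.ne', Real.rpow_add_one hY.ne']
      rcases le_total Y (2 * K * X) with h | h
      · have h1 : Y ^ q ≤ (2 * K) ^ q * X ^ q := by
          rw [← Real.mul_rpow (by linarith) hX.le]
          exact Real.rpow_le_rpow hY.le h hq
        have h2 : 0 ≤ 1 / 2 * (Y ^ q * Y) := by positivity
        have h3 := mul_le_mul_of_nonneg_left h1 (by positivity : 0 ≤ K * X)
        linarith
      · have h2 : 0 ≤ K * (2 * K) ^ q * (X ^ q * X) := by positivity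
        have h3 := mul_le_mul_of_nonneg_left h (by positivity : 0 ≤ Y ^ q / 2)
        linarith
    have h1 := h0 (F 0) hF0 ε hε
    have hX : 0 < (F 0).re ^ 2 + ε := by positivity
    have h3 : ‖F 0‖ ^ (2 * (q + 1)) ≤ K * (((F 0).re ^ 2 + ε) * ((F 0).re ^ 2 + 0 ^ 2 + ε) ^ q)
          - ((F 0).re ^ 2 + 0 ^ 2 + ε) ^ (q + 1) := by
      rw [show (F 0).re ^ 2 + 0 ^ 2 + ε = (F 0).re ^ 2 + ε by ring]
      rw [Real.rpow_add_one hX.ne'] at h1 ⊢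
      have : 0 ≤ (K - 2) * (((F 0).re ^ 2 + ε) * ((F 0).re ^ 2 + ε) ^ q) := by
        have : 0 ≤ K - 2 := by linarith
        positivity
      linarith
    have h4 := mul_le_mul_of_nonneg_left h3 (by linarith : 0 ≤ 2 * Real.pi)
    have h5 : 0 ≤ 2 * Real.pi * ‖F 0‖ ^ (2 * (q + 1)) := by positivity
    linarith [hint F hF ε hε]

/-- M. Riesz's inequality on the unit circle, for entire functions that are real at the origin. -/
theorem exists_riesz_inequality {p : ℝ} (hp : 1 < p) :
    ∃ C : ℝ, 0 ≤ C ∧ ∀ F : ℂ → ℂ, Differentiable ℂ F → (F 0).im = 0 →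
      2 * Real.pi * ‖F 0‖ ^ p + ∫ t in (-Real.pi)..Real.pi, ‖F (circleMap 0 1 t)‖ ^ p
        ≤ C * ∫ t in (-Real.pi)..Real.pi, |(F (circleMap 0 1 t)).re| ^ p := by
  obtain ⟨C, hC, h⟩ := exists_riesz_inequality_regularized hp
  refine ⟨C, hC, fun F hF hF0 => ?_⟩
  have hc : Continuous fun t => F (circleMap 0 1 t) :=
    hF.continuous.comp (continuous_circleMap 0 1)
  have hcont : Continuous fun ε : ℝ => C * ∫ t in (-Real.pi)..Real.pi,
      ((F (circleMap 0 1 t)).re ^ 2 + ε) ^ (p / 2) := by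
    refine (intervalIntegral.continuous_parametric_intervalIntegral_of_continuous' ?_ _ _).const_mul
      C
    refine Continuous.rpow_const ?_ fun _ => Or.inr (by linarith)
    exact ((continuous_re.comp (hc.comp continuous_snd)).pow 2).add continuous_fst
  have hlim := (hcont.tendsto 0).mono_left (nhdsWithin_le_nhds (s := Set.Ioi 0))
  have h0 : (∫ t in (-Real.pi)..Real.pi, ((F (circleMap 0 1 t)).re ^ 2 + 0) ^ (p / 2))
      = ∫ t in (-Real.pi)..Real.pi, |(F (circleMap 0 1 t)).re| ^ p := by
    congr 1; funext t
    rw [add_zero, ← sq_abs, ← Real.rpow_natCast_mul (abs_nonneg _)]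
    congr 1; push_cast; ring
  rw [h0] at hlim
  exact ge_of_tendsto hlim (Filter.eventually_of_mem self_mem_nhdsWithin
    fun ε hε => h F hF hF0 ε hε)

/-! ### Taylor sections on circles -/

theorem norm_add_three_rpow_le {p : ℝ} (hp : 0 ≤ p) (x y z : ℂ) :
    ‖x + y + z‖ ^ p ≤ 3 ^ p * (‖x‖ ^ p + ‖y‖ ^ p + ‖z‖ ^ p) := by
  have hx := Real.rpow_nonneg (norm_nonneg x) p
  have hy := Real.rpow_nonneg (norm_nonneg y) p
  have hz := Real.rpow_nonneg (norm_nonneg z) p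
  have key : ∀ m : ℝ, 0 ≤ m → ‖x‖ ≤ m → ‖y‖ ≤ m → ‖z‖ ≤ m →
      m ^ p ≤ ‖x‖ ^ p + ‖y‖ ^ p + ‖z‖ ^ p →
      ‖x + y + z‖ ^ p ≤ 3 ^ p * (‖x‖ ^ p + ‖y‖ ^ p + ‖z‖ ^ p) := by
    intro m hm h1 h2 h3 h
    calc ‖x + y + z‖ ^ p ≤ (3 * m) ^ p :=
          Real.rpow_le_rpow (norm_nonneg _) (norm_add₃_le.trans (by linarith)) hp
      _ = 3 ^ p * m ^ p := Real.mul_rpow (by norm_num) hm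
      _ ≤ _ := by gcongr
  rcases le_total ‖x‖ ‖y‖ with h | h <;> rcases le_total ‖y‖ ‖z‖ with h' | h' <;>
    rcases le_total ‖x‖ ‖z‖ with h'' | h''
  all_goals first
    | exact key ‖x‖ (norm_nonneg _) (by linarith) (by linarith) (by linarith) (by linarith)
    | exact key ‖y‖ (norm_nonneg _) (by linarith) (by linarith) (by linarith) (by linarith)
    | exact key ‖z‖ (norm_nonneg _) (by linarith) (by linarith) (by linarith) (by linarith)

/-- The operators truncating an analytic polynomial to degree `< m` are bounded in `L^p` of the unit
circle, uniformly in `m`. -/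
theorem exists_partialSum_bound_circle {p : ℝ} (hp : 1 < p) :
    ∃ C : ℝ, 0 ≤ C ∧ ∀ (b : ℕ → ℂ) (m N : ℕ), m < N →
      ∫ t in (-Real.pi)..Real.pi, ‖∑ k ∈ Finset.range m, b k * circleMap 0 1 t ^ k‖ ^ p
        ≤ C * ∫ t in (-Real.pi)..Real.pi,
          ‖∑ k ∈ Finset.range N, b k * circleMap 0 1 t ^ k‖ ^ p := by
  obtain ⟨C, hC, hR⟩ := exists_riesz_inequality hp
  have hp0 : 0 ≤ p := by linarith
  have hpi := Real.pi_pos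
  refine ⟨3 ^ p * (1 + 3 ^ p) * (2 * C), by positivity, fun b m N hmN => ?_⟩
  set A : ℂ → ℂ := fun z => ∑ k ∈ Finset.range N, if m < k then b k * z ^ (k - m) else 0 with hA
  set B : ℂ → ℂ := fun z => ∑ k ∈ Finset.range m, (starRingEnd ℂ) (b k) * z ^ (m - k) with hB
  set c : ℂ := b m with hc
  have hAd : Differentiable ℂ A := by
    refine Differentiable.fun_sum fun k _ => ?_
    split_ifs <;> fun_prop
  have hBd : Differentiable ℂ B := by
    refine Differentiable.fun_sum fun k _ => ?_
    fun_prop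
  have hA0 : A 0 = 0 := by
    refine Finset.sum_eq_zero fun k _ => ?_
    split_ifs with h
    · rw [zero_pow (by omega), mul_zero]
    · rfl
  have hB0 : B 0 = 0 := by
    refine Finset.sum_eq_zero fun k hk => ?_
    rw [zero_pow (by have := Finset.mem_range.1 hk; omega), mul_zero]
  -- On the unit circle the real parts of `F` and `H` are the real and imaginary parts of
  -- `e ^ (-m) * Q`, where `Q` is the given polynomial, and `F - i H = 2 B + conj c`.
  set F : ℂ → ℂ := fun z => c.re + A z + B z with hF
  set H : ℂ → ℂ := fun z => c.im - I * (A z - B z) with hH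
  have hFd : Differentiable ℂ F := by fun_prop
  have hHd : Differentiable ℂ H := by fun_prop
  set e : ℝ → ℂ := circleMap 0 1 with he
  have hec : Continuous e := continuous_circleMap 0 1
  have hne : ∀ t, ‖e t‖ = 1 := fun t => by simp [he]
  have hne0 : ∀ t, e t ≠ 0 := fun t h => by simpa [h] using hne t
  have hconj : ∀ t, (starRingEnd ℂ) (e t) = (e t)⁻¹ := fun t =>
    (Complex.inv_eq_conj (hne t)).symm
  set Q : ℝ → ℂ := fun t => ∑ k ∈ Finset.range N, b k * e t ^ k with hQ
  set S : ℝ → ℂ := fun t => ∑ k ∈ Finset.range m, b k * e t ^ k with hS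
  have hSB : ∀ t, S t = e t ^ m * (starRingEnd ℂ) (B (e t)) := by
    intro t
    simp only [hS, hB, map_sum, map_mul, map_pow, conj_conj, hconj, Finset.mul_sum]
    refine Finset.sum_congr rfl fun k hk => ?_
    have hk : k ≤ m := (Finset.mem_range.1 hk).le
    rw [inv_pow, mul_left_comm, ← div_eq_mul_inv]
    congr 1
    rw [eq_div_iff (pow_ne_zero _ (hne0 t)), ← pow_add]
    congr 1; omega
  have hQA : ∀ t, Q t = e t ^ m * (A (e t) + c + (starRingEnd ℂ) (B (e t))) := by
    intro t
    have h1 : Q t = S t + b m * e t ^ m + ∑ k ∈ Finset.range N,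
        if m < k then b k * e t ^ k else 0 := by
      have h2 : S t + b m * e t ^ m = ∑ k ∈ Finset.range N,
          if m < k then 0 else b k * e t ^ k := by
        rw [hS, ← Finset.sum_range_succ (fun k => b k * e t ^ k),
          ← Finset.sum_subset (Finset.range_subset_range.2 (by omega : m + 1 ≤ N))]
        · refine Finset.sum_congr rfl fun k hk => ?_
          rw [if_neg (by have := Finset.mem_range.1 hk; omega)]
        · intro k _ hk
          rw [if_pos (by have := mt Finset.mem_range.2 hk; omega)]
      rw [h2, ← Finset.sum_add_distrib]
      refine Finset.sum_congr rfl fun k _ => ?_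
      split_ifs <;> simp
    have h3 : (∑ k ∈ Finset.range N, if m < k then b k * e t ^ k else 0) = e t ^ m * A (e t) := by
      rw [hA, Finset.mul_sum]
      refine Finset.sum_congr rfl fun k _ => ?_
      split_ifs with h
      · rw [mul_left_comm, ← pow_add]; congr 2; omega
      · simp
    rw [h1, h3, hSB t]
    ring
  have hnQ : ∀ t, ‖Q t‖ = ‖A (e t) + c + (starRingEnd ℂ) (B (e t))‖ := fun t => by
    rw [hQA, norm_mul, norm_pow, hne, one_pow, one_mul]
  have hFre : ∀ t, |(F (e t)).re| ≤ ‖Q t‖ := fun t => by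
    rw [hnQ]
    refine le_trans (le_of_eq ?_) (abs_re_le_norm _)
    simp [hF]; ring_nf
  have hHre : ∀ t, |(H (e t)).re| ≤ ‖Q t‖ := fun t => by
    rw [hnQ]
    refine le_trans (le_of_eq ?_) (abs_im_le_norm _)
    simp [hH]; ring_nf
  have hQc : Continuous Q := by fun_prop
  have hSc : Continuous S := by fun_prop
  have hcp : ∀ {G : ℝ → ℂ}, Continuous G → Continuous fun t => ‖G t‖ ^ p := fun hG =>
    hG.norm.rpow_const fun _ => Or.inr hp0
  have hbound : ∀ G : ℂ → ℂ, Differentiable ℂ G → (∀ t, |(G (e t)).re| ≤ ‖Q t‖) →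
      (∫ t in (-Real.pi)..Real.pi, |(G (e t)).re| ^ p) ≤ ∫ t in (-Real.pi)..Real.pi, ‖Q t‖ ^ p := by
    intro G hG h
    refine intervalIntegral.integral_mono_on (by linarith) (Continuous.intervalIntegrable ?_ _ _)
      ((hcp hQc).intervalIntegrable _ _) fun t _ =>
        Real.rpow_le_rpow (abs_nonneg _) (h t) hp0
    exact (continuous_re.comp (hG.continuous.comp hec)).abs.rpow_const fun _ => Or.inr hp0
  have hF' := (hR F hFd (by simp [hF, hA0, hB0])).trans
    (mul_le_mul_of_nonneg_left (hbound F hFd hFre) hC)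
  have hH' := (hR H hHd (by simp [hH, hA0, hB0])).trans
    (mul_le_mul_of_nonneg_left (hbound H hHd hHre) hC)
  have hSF : ∀ t, ‖S t‖ ^ p ≤ 3 ^ p * (‖F (e t)‖ ^ p + ‖H (e t)‖ ^ p
      + 3 ^ p * (‖F 0‖ ^ p + ‖H 0‖ ^ p)) := by
    intro t
    have h1 : (2 : ℂ) * B (e t) = F (e t) + (-I) * H (e t) + (-(starRingEnd ℂ) c) := by
      have hcc : (starRingEnd ℂ) c = c.re - I * c.im := by
        apply Complex.ext <;> simp
      rw [hcc]
      simp only [hF, hH]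
      linear_combination (-(A (e t) - B (e t))) * I_mul_I
    have h2 : ‖S t‖ ≤ ‖F (e t) + (-I) * H (e t) + (-(starRingEnd ℂ) c)‖ := by
      rw [← h1, hSB, norm_mul, norm_pow, hne, one_pow, one_mul, RCLike.norm_conj, norm_mul]
      have := norm_nonneg (B (e t))
      simp; linarith
    have h3 : ‖-(starRingEnd ℂ) c‖ ^ p ≤ 3 ^ p * (‖F 0‖ ^ p + ‖H 0‖ ^ p) := by
      have h4 := norm_add_three_rpow_le hp0 (F 0) (I * H 0) 0
      have h5 : F 0 + I * H 0 + 0 = c := by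
        simp only [hF, hH, hA0, hB0]
        apply Complex.ext <;> simp
      rw [h5, norm_mul, norm_I, one_mul, norm_zero, Real.zero_rpow (by linarith), add_zero] at h4
      rwa [norm_neg, RCLike.norm_conj]
    calc ‖S t‖ ^ p ≤ ‖F (e t) + (-I) * H (e t) + (-(starRingEnd ℂ) c)‖ ^ p :=
          Real.rpow_le_rpow (norm_nonneg _) h2 hp0
      _ ≤ 3 ^ p * (‖F (e t)‖ ^ p + ‖-I * H (e t)‖ ^ p + ‖-(starRingEnd ℂ) c‖ ^ p) :=
          norm_add_three_rpow_le hp0 _ _ _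
      _ ≤ _ := by
          rw [norm_mul, norm_neg, norm_I, one_mul]
          gcongr
  have hFi := (hcp (hFd.continuous.comp hec)).intervalIntegrable
    (μ := MeasureTheory.volume) (-Real.pi) Real.pi
  have hHi := (hcp (hHd.continuous.comp hec)).intervalIntegrable
    (μ := MeasureTheory.volume) (-Real.pi) Real.pi
  have hfin : (∫ t in (-Real.pi)..Real.pi, ‖S t‖ ^ p) ≤
      3 ^ p * ((∫ t in (-Real.pi)..Real.pi, ‖F (e t)‖ ^ p)
        + (∫ t in (-Real.pi)..Real.pi, ‖H (e t)‖ ^ p)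
        + 2 * Real.pi * (3 ^ p * (‖F 0‖ ^ p + ‖H 0‖ ^ p))) := by
    refine (intervalIntegral.integral_mono_on (by linarith) ((hcp hSc).intervalIntegrable _ _)
      (((hFi.add hHi).add intervalIntegrable_const).const_mul _) fun t _ => hSF t).trans
      (le_of_eq ?_)
    rw [intervalIntegral.integral_const_mul,
      intervalIntegral.integral_add (hFi.add hHi) intervalIntegrable_const,
      intervalIntegral.integral_add hFi hHi, intervalIntegral.integral_const]
    simp only [Function.comp, smul_eq_mul]
    ring
  refine hfin.trans ?_
  have n1 : 0 ≤ ∫ t in (-Real.pi)..Real.pi, ‖F (e t)‖ ^ p :=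
    intervalIntegral.integral_nonneg (by linarith) fun t _ => by positivity
  have n2 : 0 ≤ ∫ t in (-Real.pi)..Real.pi, ‖H (e t)‖ ^ p :=
    intervalIntegral.integral_nonneg (by linarith) fun t _ => by positivity
  have n3 : 0 ≤ 2 * Real.pi * ‖F 0‖ ^ p := by positivity
  have n4 : 0 ≤ 2 * Real.pi * ‖H 0‖ ^ p := by positivity
  have n5 : (0 : ℝ) ≤ 3 ^ p := by positivity
  suffices h : (∫ t in (-Real.pi)..Real.pi, ‖F (e t)‖ ^ p)
        + (∫ t in (-Real.pi)..Real.pi, ‖H (e t)‖ ^ p)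
        + 2 * Real.pi * (3 ^ p * (‖F 0‖ ^ p + ‖H 0‖ ^ p))
      ≤ (1 + 3 ^ p) * (2 * C * ∫ t in (-Real.pi)..Real.pi, ‖Q t‖ ^ p) by
    exact (mul_le_mul_of_nonneg_left h n5).trans_eq (by ring)
  have hs := mul_le_mul_of_nonneg_left (add_le_add hF' hH') (by linarith : (0 : ℝ) ≤ 1 + 3 ^ p)
  have := mul_nonneg n5 n1
  have := mul_nonneg n5 n2
  linarith

theorem summable_norm_coeff_of_hasSum {f : ℂ → ℂ} {a : ℕ → ℂ}
    (hf : ∀ z ∈ unitDisk, HasSum (fun k : ℕ => a k * z ^ k) (f z)) {r : ℝ} (hr : 0 ≤ r)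
    (hr1 : r < 1) : Summable fun k => ‖a k‖ * r ^ k := by
  have h := (hf r (by simp [unitDisk, abs_of_nonneg hr, hr1])).summable.norm
  simpa [abs_of_nonneg hr] using h

theorem circleMap_mem_unitDisk {r : ℝ} (hr : 0 ≤ r) (hr1 : r < 1) (t : ℝ) :
    circleMap 0 r t ∈ unitDisk := by
  simp [unitDisk, abs_of_nonneg hr, hr1]

theorem continuous_comp_circleMap {f : ℂ → ℂ} {a : ℕ → ℂ}
    (hf : ∀ z ∈ unitDisk, HasSum (fun k : ℕ => a k * z ^ k) (f z)) {r : ℝ} (hr : 0 ≤ r)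
    (hr1 : r < 1) : Continuous fun t => f (circleMap 0 r t) := by
  have h : (fun t => f (circleMap 0 r t)) = fun t => ∑' k, a k * circleMap 0 r t ^ k :=
    funext fun t => ((hf _ (circleMap_mem_unitDisk hr hr1 t)).tsum_eq).symm
  rw [h]
  refine continuous_tsum (fun k => by fun_prop) (summable_norm_coeff_of_hasSum hf hr hr1)
    fun k t => ?_
  simp [abs_of_nonneg hr]

theorem tendsto_integral_partialSum_circle {p : ℝ} (hp : 0 < p) {f g : ℂ → ℂ} {a : ℕ → ℂ}
    (hf : ∀ z ∈ unitDisk, HasSum (fun k : ℕ => a k * z ^ k) (f z)) {r : ℝ} (hr : 0 ≤ r)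
    (hr1 : r < 1) (hg : Continuous fun t => g (circleMap 0 r t)) :
    Filter.Tendsto (fun N => ∫ t in (-Real.pi)..Real.pi,
        ‖g (circleMap 0 r t) - ∑ k ∈ Finset.range N, a k * circleMap 0 r t ^ k‖ ^ p) Filter.atTop
      (nhds (∫ t in (-Real.pi)..Real.pi, ‖g (circleMap 0 r t) - f (circleMap 0 r t)‖ ^ p)) := by
  have hsum := summable_norm_coeff_of_hasSum hf hr hr1
  refine intervalIntegral.tendsto_integral_filter_of_dominated_convergence
    (fun t => (‖g (circleMap 0 r t)‖ + ∑' k, ‖a k‖ * r ^ k) ^ p)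
    (Filter.Eventually.of_forall fun N => Continuous.aestronglyMeasurable ?_)
    (Filter.Eventually.of_forall fun N => Filter.Eventually.of_forall fun t _ => ?_)
    (Continuous.intervalIntegrable ?_ _ _) (Filter.Eventually.of_forall fun t _ => ?_)
  · exact (hg.sub (by fun_prop)).norm.rpow_const fun _ => Or.inr hp.le
  · rw [Real.norm_of_nonneg (by positivity)]
    refine Real.rpow_le_rpow (norm_nonneg _) ((norm_sub_le _ _).trans ?_) hp.le
    gcongr
    refine (norm_sum_le _ _).trans (le_trans (le_of_eq ?_) (hsum.sum_le_tsum (Finset.range N)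
      fun k _ => by positivity))
    simp [abs_of_nonneg hr]
  · exact (hg.norm.add continuous_const).rpow_const fun _ => Or.inr hp.le
  · refine Filter.Tendsto.rpow_const ?_ (Or.inr hp.le)
    exact ((hf _ (circleMap_mem_unitDisk hr hr1 t)).tendsto_sum_nat.const_sub _).norm

/-- The bound for polynomials passes to power series by letting the degree tend to infinity on a
circle of radius `r < 1`. -/
theorem exists_partialSum_bound_circle_of_hasSum {p : ℝ} (hp : 1 < p) :
    ∃ C : ℝ, 0 ≤ C ∧ ∀ (f : ℂ → ℂ) (a : ℕ → ℂ),
      (∀ z ∈ unitDisk, HasSum (fun k : ℕ => a k * z ^ k) (f z)) →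
      ∀ (m : ℕ) (r : ℝ), 0 ≤ r → r < 1 →
      ∫ t in (-Real.pi)..Real.pi, ‖∑ k ∈ Finset.range m, a k * circleMap 0 r t ^ k‖ ^ p
        ≤ C * ∫ t in (-Real.pi)..Real.pi, ‖f (circleMap 0 r t)‖ ^ p := by
  obtain ⟨C, hC, h⟩ := exists_partialSum_bound_circle hp
  refine ⟨C, hC, fun f a hf m r hr hr1 => ?_⟩
  have hlim := (tendsto_integral_partialSum_circle (g := 0) (by linarith : 0 < p) hf hr hr1
    continuous_const).const_mul C
  simp only [Pi.zero_apply, zero_sub, norm_neg] at hlim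
  refine ge_of_tendsto hlim ((Filter.eventually_gt_atTop m).mono fun N hN => ?_)
  have := h (fun k => a k * (r : ℂ) ^ k) m N hN
  simpa only [mul_assoc, ← mul_pow, show ∀ t, (r : ℂ) * circleMap 0 1 t = circleMap 0 r t from
    fun t => by simp [circleMap]] using this

/-! ### Taylor sections in the disk -/

theorem lintegral_unitDisk_eq_polar (g : ℂ → ℝ≥0∞) (hg : Measurable g) :
    ∫⁻ z in unitDisk, g z = ∫⁻ r in Set.Ioo (0 : ℝ) 1, ENNReal.ofReal r *
      ∫⁻ t in Set.Ioc (-Real.pi) Real.pi, g (circleMap 0 r t) := by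
  have hmeas : MeasurableSet unitDisk := measurableSet_ball
  have hcm : Measurable fun x : ℝ × ℝ => circleMap 0 x.1 x.2 := by
    unfold circleMap; fun_prop
  have hind : Measurable (unitDisk.indicator g) := hg.indicator hmeas
  have hpol : ∀ x : ℝ × ℝ, Complex.polarCoord.symm x = circleMap 0 x.1 x.2 := fun x => by
    simp [circleMap, exp_mul_I]
  rw [← MeasureTheory.lintegral_indicator hmeas, ← Complex.lintegral_comp_polarCoord_symm,
    polarCoord_target, MeasureTheory.Measure.volume_eq_prod,
    ← MeasureTheory.Measure.prod_restrict]
  simp only [hpol, smul_eq_mul]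
  rw [MeasureTheory.lintegral_prod]
  swap
  · exact ((measurable_fst.ennreal_ofReal).mul (hind.comp hcm)).aemeasurable
  rw [← MeasureTheory.lintegral_indicator measurableSet_Ioi,
    ← MeasureTheory.lintegral_indicator measurableSet_Ioo]
  refine MeasureTheory.lintegral_congr fun r => ?_
  by_cases h0 : 0 < r
  swap
  · rw [Set.indicator_of_notMem (by simpa using h0), Set.indicator_of_notMem fun h => h0 h.1]
  rw [Set.indicator_of_mem (by simpa using h0)]
  have hmr : Measurable fun t => unitDisk.indicator g (circleMap 0 r t) :=
    hind.comp (continuous_circleMap 0 r).measurable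
  dsimp only
  rw [MeasureTheory.lintegral_const_mul _ hmr,
    MeasureTheory.restrict_Ioo_eq_restrict_Ioc]
  by_cases h1 : r < 1
  · rw [Set.indicator_of_mem (Set.mem_Ioo.2 ⟨h0, h1⟩)]
    congr 1
    exact MeasureTheory.lintegral_congr fun t =>
      Set.indicator_of_mem (circleMap_mem_unitDisk h0.le h1 t) _
  · rw [Set.indicator_of_notMem fun h => h1 h.2]
    have : ∀ t, unitDisk.indicator g (circleMap 0 r t) = 0 := fun t =>
      Set.indicator_of_notMem (by simpa [unitDisk, abs_of_pos h0] using h1) _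
    simp [this]

theorem lintegral_circle_eq_ofReal {p : ℝ} (hp : 0 ≤ p) {G : ℝ → ℂ} (hG : Continuous G) :
    ∫⁻ t in Set.Ioc (-Real.pi) Real.pi, ENNReal.ofReal (‖G t‖ ^ p)
      = ENNReal.ofReal (∫ t in (-Real.pi)..Real.pi, ‖G t‖ ^ p) := by
  have hle : -Real.pi ≤ Real.pi := by linarith [Real.pi_pos]
  rw [intervalIntegral.integral_of_le hle, ofReal_integral_eq_lintegral_ofReal]
  · exact (intervalIntegrable_iff_integrableOn_Ioc_of_le hle).1
      ((hG.norm.rpow_const fun _ => Or.inr hp).intervalIntegrable _ _)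
  · exact Filter.Eventually.of_forall fun t => by positivity

theorem measurable_ofReal_norm_rpow {p : ℝ} {f : ℂ → ℂ} (hf : Measurable f) :
    Measurable fun z => ENNReal.ofReal (‖f z‖ ^ p) :=
  (hf.norm.pow_const p).ennreal_ofReal

theorem exists_remainder_bound_circle {p : ℝ} (hp : 1 < p) :
    ∃ C : ℝ, 0 ≤ C ∧ ∀ (f : ℂ → ℂ) (a : ℕ → ℂ),
      (∀ z ∈ unitDisk, HasSum (fun k : ℕ => a k * z ^ k) (f z)) →
      ∀ (m : ℕ) (r : ℝ), 0 ≤ r → r < 1 →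
      ∫ t in (-Real.pi)..Real.pi,
          ‖f (circleMap 0 r t) - ∑ k ∈ Finset.range m, a k * circleMap 0 r t ^ k‖ ^ p
        ≤ C * ∫ t in (-Real.pi)..Real.pi, ‖f (circleMap 0 r t)‖ ^ p := by
  obtain ⟨C, hC, h⟩ := exists_partialSum_bound_circle_of_hasSum hp
  have hp0 : 0 ≤ p := by linarith
  refine ⟨3 ^ p * (1 + C), by positivity, fun f a hf m r hr hr1 => ?_⟩
  have hfc := continuous_comp_circleMap hf hr hr1
  have hsc : Continuous fun t => ∑ k ∈ Finset.range m, a k * circleMap 0 r t ^ k := by fun_prop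
  have hfi := (hfc.norm.rpow_const fun _ => Or.inr hp0).intervalIntegrable
    (μ := volume) (-Real.pi) Real.pi
  have hsi := (hsc.norm.rpow_const fun _ => Or.inr hp0).intervalIntegrable
    (μ := volume) (-Real.pi) Real.pi
  have h3 : (0 : ℝ) ≤ 3 ^ p := by positivity
  calc _ ≤ ∫ t in (-Real.pi)..Real.pi, 3 ^ p * (‖f (circleMap 0 r t)‖ ^ p
          + ‖∑ k ∈ Finset.range m, a k * circleMap 0 r t ^ k‖ ^ p) := by
        refine intervalIntegral.integral_mono_on (by linarith [Real.pi_pos])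
          (((hfc.sub hsc).norm.rpow_const fun _ => Or.inr hp0).intervalIntegrable _ _)
          ((hfi.add hsi).const_mul _) fun t _ => ?_
        have := norm_add_three_rpow_le hp0 (f (circleMap 0 r t))
          (-∑ k ∈ Finset.range m, a k * circleMap 0 r t ^ k) 0
        rwa [norm_neg, norm_zero, Real.zero_rpow (by linarith), add_zero, add_zero,
          ← sub_eq_add_neg] at this
    _ = 3 ^ p * ((∫ t in (-Real.pi)..Real.pi, ‖f (circleMap 0 r t)‖ ^ p)
        + ∫ t in (-Real.pi)..Real.pi,
          ‖∑ k ∈ Finset.range m, a k * circleMap 0 r t ^ k‖ ^ p) := by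
        rw [intervalIntegral.integral_const_mul, intervalIntegral.integral_add hfi hsi]
    _ ≤ _ := by
        rw [mul_assoc]
        exact mul_le_mul_of_nonneg_left (by linarith [h f a hf m r hr hr1]) h3

theorem exists_remainder_bound_lintegral {p : ℝ} (hp : 1 < p) :
    ∃ C : ℝ≥0∞, C ≠ ∞ ∧ ∀ (f : ℂ → ℂ) (a : ℕ → ℂ),
      (∀ z ∈ unitDisk, HasSum (fun k : ℕ => a k * z ^ k) (f z)) →
      ∀ m : ℕ, ∀ r ∈ Set.Ioo (0 : ℝ) 1,
      ∫⁻ t in Set.Ioc (-Real.pi) Real.pi, ENNReal.ofReal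
          (‖f (circleMap 0 r t) - ∑ k ∈ Finset.range m, a k * circleMap 0 r t ^ k‖ ^ p)
        ≤ C * ∫⁻ t in Set.Ioc (-Real.pi) Real.pi, ENNReal.ofReal (‖f (circleMap 0 r t)‖ ^ p) := by
  obtain ⟨C, hC, h⟩ := exists_remainder_bound_circle hp
  have hp0 : 0 ≤ p := by linarith
  refine ⟨ENNReal.ofReal C, ENNReal.ofReal_ne_top, fun f a hf m r hr => ?_⟩
  have hfc := continuous_comp_circleMap hf hr.1.le hr.2
  have hsc : Continuous fun t => ∑ k ∈ Finset.range m, a k * circleMap 0 r t ^ k := by fun_prop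
  rw [lintegral_circle_eq_ofReal hp0 hfc, lintegral_circle_eq_ofReal hp0 (hfc.fun_sub hsc),
    ← ENNReal.ofReal_mul hC]
  exact ENNReal.ofReal_le_ofReal (h f a hf m r hr.1.le hr.2)

theorem measurable_partialSum (a : ℕ → ℂ) (m : ℕ) :
    Measurable fun z : ℂ => ∑ k ∈ Finset.range m, a k * z ^ k := by fun_prop

/-- The Taylor remainders are bounded on `A^p`, uniformly in `m`. -/
theorem exists_remainder_bound_disk {p : ℝ} (hp : 1 < p) :
    ∃ C : ℝ≥0∞, C ≠ ∞ ∧ ∀ (f : ℂ → ℂ) (a : ℕ → ℂ), Measurable f →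
      (∀ z ∈ unitDisk, HasSum (fun k : ℕ => a k * z ^ k) (f z)) → ∀ m : ℕ,
      ∫⁻ z in unitDisk, ENNReal.ofReal (‖f z - ∑ k ∈ Finset.range m, a k * z ^ k‖ ^ p)
        ≤ C * ∫⁻ z in unitDisk, ENNReal.ofReal (‖f z‖ ^ p) := by
  obtain ⟨C, hC, h⟩ := exists_remainder_bound_lintegral hp
  refine ⟨C, hC, fun f a hfm hf m => ?_⟩
  rw [lintegral_unitDisk_eq_polar _ (measurable_ofReal_norm_rpow hfm),
    lintegral_unitDisk_eq_polar _
      (measurable_ofReal_norm_rpow (hfm.fun_sub (measurable_partialSum a m))),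
    ← lintegral_const_mul' _ _ hC]
  refine setLIntegral_mono' measurableSet_Ioo fun r hr => ?_
  rw [mul_left_comm]
  exact mul_le_mul_right (h f a hf m r hr) _

/-- Taylor sections converge in `A^p`: dominated convergence in the radius, the integral of `|f|^p`
over each circle, up to a constant, being the majorant. -/
theorem tendsto_lintegral_remainder_disk {p : ℝ} (hp : 1 < p) {f : ℂ → ℂ} {a : ℕ → ℂ}
    (hfm : Measurable f) (hf : ∀ z ∈ unitDisk, HasSum (fun k : ℕ => a k * z ^ k) (f z))
    (hfin : ∫⁻ z in unitDisk, ENNReal.ofReal (‖f z‖ ^ p) ≠ ∞) :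
    Filter.Tendsto (fun m => ∫⁻ z in unitDisk,
        ENNReal.ofReal (‖f z - ∑ k ∈ Finset.range m, a k * z ^ k‖ ^ p)) Filter.atTop (nhds 0) := by
  obtain ⟨C, hC, h⟩ := exists_remainder_bound_lintegral hp
  have hcm : Measurable fun x : ℝ × ℝ => circleMap 0 x.1 x.2 := by
    unfold circleMap; fun_prop
  have hp0 : 0 < p := by linarith
  have hrm := fun m => measurable_ofReal_norm_rpow (p := p) (hfm.fun_sub (measurable_partialSum a m))
  rw [lintegral_unitDisk_eq_polar _ (measurable_ofReal_norm_rpow hfm)] at hfin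
  have hEq := fun m => lintegral_unitDisk_eq_polar _ (hrm m)
  simp only [hEq]
  have h0 : ∫⁻ r in Set.Ioo (0 : ℝ) 1, (0 : ℝ≥0∞) = 0 := by simp
  rw [← h0]
  refine tendsto_lintegral_of_dominated_convergence (fun r => C * (ENNReal.ofReal r *
      ∫⁻ t in Set.Ioc (-Real.pi) Real.pi, ENNReal.ofReal (‖f (circleMap 0 r t)‖ ^ p)))
    (fun m => ?_) (fun m => ?_) ?_ ?_
  · exact measurable_id.ennreal_ofReal.mul ((hrm m).comp hcm).lintegral_prod_right'
  · refine (ae_restrict_iff' measurableSet_Ioo).2 (Filter.Eventually.of_forall fun r hr => ?_)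
    dsimp only
    rw [mul_left_comm]
    exact mul_le_mul_right (h f a hf m r hr) _
  · rw [lintegral_const_mul' _ _ hC]
    exact ENNReal.mul_ne_top hC hfin
  · refine (ae_restrict_iff' measurableSet_Ioo).2 (Filter.Eventually.of_forall fun r hr => ?_)
    have hfc := continuous_comp_circleMap hf hr.1.le hr.2
    have hlim := tendsto_integral_partialSum_circle hp0 hf hr.1.le hr.2 hfc
    simp only [sub_self, norm_zero, Real.zero_rpow hp0.ne', intervalIntegral.integral_zero]
      at hlim
    have hlim' := ENNReal.Tendsto.const_mul (a := ENNReal.ofReal r) (ENNReal.tendsto_ofReal hlim)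
      (Or.inr ENNReal.ofReal_ne_top)
    rw [ENNReal.ofReal_zero, mul_zero] at hlim'
    refine hlim'.congr fun m => ?_
    rw [← lintegral_circle_eq_ofReal hp0.le (hfc.fun_sub (by fun_prop))]

theorem lintegral_norm_sub_rpow_le {p : ℝ} (hp : 0 < p) {f g : ℂ → ℂ} (hf : Measurable f) :
    ∫⁻ z in unitDisk, ENNReal.ofReal (‖f z - g z‖ ^ p) ≤ ENNReal.ofReal (3 ^ p) *
      ((∫⁻ z in unitDisk, ENNReal.ofReal (‖f z‖ ^ p))
        + ∫⁻ z in unitDisk, ENNReal.ofReal (‖g z‖ ^ p)) := by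
  rw [← lintegral_add_left (measurable_ofReal_norm_rpow hf),
    ← lintegral_const_mul' _ _ ENNReal.ofReal_ne_top]
  refine lintegral_mono fun z => ?_
  rw [← ENNReal.ofReal_add (by positivity) (by positivity), ← ENNReal.ofReal_mul (by positivity)]
  refine ENNReal.ofReal_le_ofReal ?_
  have := norm_add_three_rpow_le hp.le (f z) (-g z) 0
  rwa [norm_neg, norm_zero, Real.zero_rpow hp.ne', add_zero, add_zero, ← sub_eq_add_neg] at this

theorem lintegral_continuous_ne_top {p : ℝ} (hp : 0 ≤ p) {g : ℂ → ℂ} (hg : Continuous g) :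
    ∫⁻ z in unitDisk, ENNReal.ofReal (‖g z‖ ^ p) ≠ ∞ := by
  have h1 : IntegrableOn (fun z => ‖g z‖ ^ p) (Metric.closedBall (0 : ℂ) 1) :=
    (hg.norm.rpow_const fun _ => Or.inr hp).continuousOn.integrableOn_compact
      (isCompact_closedBall 0 1)
  exact (h1.mono_set Metric.ball_subset_closedBall).lintegral_lt_top.ne

theorem lintegral_norm_pow_rpow_ne_zero (p : ℝ) (m : ℕ) :
    ∫⁻ z in unitDisk, ENNReal.ofReal (‖z ^ m‖ ^ p) ≠ 0 := by
  refine ((setLIntegral_pos_iff (measurable_ofReal_norm_rpow (by fun_prop))).2 ?_).ne'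
  have hopen : IsOpen (unitDisk ∩ {(0 : ℂ)}ᶜ) := Metric.isOpen_ball.inter isOpen_compl_singleton
  have hne : (unitDisk ∩ {(0 : ℂ)}ᶜ).Nonempty := ⟨1 / 2, by simp [unitDisk]; norm_num⟩
  refine (hopen.measure_pos volume hne).trans_le (measure_mono fun z hz => ⟨?_, hz.1⟩)
  have hz0 : z ≠ 0 := hz.2
  exact (ENNReal.ofReal_pos.2 (Real.rpow_pos_of_pos (norm_pos_iff.2 (pow_ne_zero m hz0)) p)).ne'

/-! ### Taylor coefficients -/

/-- Taylor coefficients are bounded functionals on `A^p`, because `a m * z ^ m` is the difference of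
two consecutive Taylor remainders. -/
theorem exists_coeff_bound {p : ℝ} (hp : 1 < p) (m : ℕ) :
    ∃ C : ℝ≥0∞, C ≠ ∞ ∧ ∀ (f : ℂ → ℂ) (a : ℕ → ℂ), Measurable f →
      (∀ z ∈ unitDisk, HasSum (fun k : ℕ => a k * z ^ k) (f z)) →
      ENNReal.ofReal (‖a m‖ ^ p) ≤ C * ∫⁻ z in unitDisk, ENNReal.ofReal (‖f z‖ ^ p) := by
  obtain ⟨C, hC, h⟩ := exists_remainder_bound_disk hp
  have hp0 : 0 < p := by linarith
  set κ := ∫⁻ z in unitDisk, ENNReal.ofReal (‖z ^ m‖ ^ p) with hκ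
  have hκ0 : κ ≠ 0 := lintegral_norm_pow_rpow_ne_zero p m
  have hκt : κ ≠ ∞ := lintegral_continuous_ne_top hp0.le (by fun_prop)
  refine ⟨ENNReal.ofReal (3 ^ p) * (C + C) / κ, ENNReal.div_ne_top (by finiteness) hκ0,
    fun f a hfm hf => ?_⟩
  have h1 := lintegral_norm_sub_rpow_le hp0 (hfm.fun_sub (measurable_partialSum a m))
    (g := fun z => f z - ∑ k ∈ Finset.range (m + 1), a k * z ^ k)
  have h2 := h1.trans (mul_le_mul_right (add_le_add (h f a hfm hf m) (h f a hfm hf (m + 1))) _)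
  have h3 : ∫⁻ z in unitDisk, ENNReal.ofReal (‖f z - ∑ k ∈ Finset.range m, a k * z ^ k
      - (f z - ∑ k ∈ Finset.range (m + 1), a k * z ^ k)‖ ^ p)
      = ENNReal.ofReal (‖a m‖ ^ p) * κ := by
    rw [hκ, ← lintegral_const_mul' _ _ ENNReal.ofReal_ne_top]
    refine lintegral_congr fun z => ?_
    rw [Finset.sum_range_succ, ← ENNReal.ofReal_mul (by positivity),
      ← Real.mul_rpow (norm_nonneg _) (norm_nonneg _), ← norm_mul]
    congr 3; ring
  rw [h3, ← add_mul, ← mul_assoc] at h2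
  rw [div_eq_mul_inv, mul_right_comm, ← div_eq_mul_inv]
  exact (ENNReal.le_div_iff_mul_le (Or.inl hκ0) (Or.inl hκt)).2 h2

theorem powerSeries_coeff_unique {f : ℂ → ℂ} {a b : ℕ → ℂ}
    (ha : ∀ z ∈ unitDisk, HasSum (fun k : ℕ => a k * z ^ k) (f z))
    (hb : ∀ z ∈ unitDisk, HasSum (fun k : ℕ => b k * z ^ k) (f z)) : a = b := by
  funext m
  obtain ⟨C, -, h⟩ := exists_coeff_bound (p := 2) (by norm_num) m
  have := h (fun _ => 0) (fun k => a k - b k) measurable_const fun z hz => by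
    simpa [sub_mul] using (ha z hz).sub (hb z hz)
  simpa [sub_eq_zero] using this

theorem hasSum_taylor_unitDisk {f : ℂ → ℂ} (hf : DifferentiableOn ℂ f unitDisk) (z : ℂ)
    (hz : z ∈ unitDisk) :
    HasSum (fun k : ℕ => iteratedDeriv k f 0 / (k ! : ℂ) * z ^ k) (f z) := by
  have := hasSum_taylorSeries_on_ball hf hz
  refine this.congr_fun ?_
  intro k
  simp [smul_eq_mul]; ring

theorem hasIntegerPowerSeries_iff {f : ℂ → ℂ} (hf : DifferentiableOn ℂ f unitDisk) :
    HasIntegerPowerSeries f ↔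
      ∀ k : ℕ, ∃ m : ℤ, iteratedDeriv k f 0 / (k ! : ℂ) = (m : ℂ) := by
  constructor
  · rintro ⟨a, ha⟩ k
    exact ⟨a k, congrFun (powerSeries_coeff_unique (hasSum_taylor_unitDisk hf) ha) k⟩
  · intro h
    choose a ha using h
    exact ⟨a, fun z hz => by simpa only [ha] using hasSum_taylor_unitDisk hf z hz⟩

/-! ### Integer polynomials and the Bergman norm -/

theorem bergmanNorm_eq_lintegral (p : ℝ) {g : ℂ → ℂ}
    (hg : AEStronglyMeasurable g (volume.restrict unitDisk)) :
    bergmanNorm p g = ((1 / Real.pi) *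
      (∫⁻ z in unitDisk, ENNReal.ofReal (‖g z‖ ^ p)).toReal) ^ (1 / p) := by
  rw [bergmanNorm, integral_eq_lintegral_of_nonneg_ae]
  · exact Filter.Eventually.of_forall fun z => by positivity
  · exact (hg.norm.aemeasurable.pow_const p).aestronglyMeasurable

/-- Finiteness of the integrals matters here: a non-integrable `|g|^p` would have Bergman norm `0` by
convention. -/
theorem tendsto_bergmanNorm_iff {p : ℝ} (hp : 0 < p) {g : ℕ → ℂ → ℂ}
    (hg : ∀ n, AEStronglyMeasurable (g n) (volume.restrict unitDisk))
    (hfin : ∀ n, ∫⁻ z in unitDisk, ENNReal.ofReal (‖g n z‖ ^ p) ≠ ∞) :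
    Filter.Tendsto (fun n => bergmanNorm p (g n)) Filter.atTop (nhds 0) ↔
      Filter.Tendsto (fun n => ∫⁻ z in unitDisk, ENNReal.ofReal (‖g n z‖ ^ p))
        Filter.atTop (nhds 0) := by
  have hpi := Real.pi_pos
  rw [← ENNReal.tendsto_toReal_iff hfin ENNReal.zero_ne_top, ENNReal.toReal_zero]
  simp only [fun n => bergmanNorm_eq_lintegral p (hg n)]
  constructor
  · intro h
    have h1 := (h.rpow_const (p := p) (Or.inr hp.le)).const_mul Real.pi
    rw [Real.zero_rpow hp.ne', mul_zero] at h1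
    refine h1.congr fun n => ?_
    rw [← Real.rpow_mul (by positivity), one_div_mul_cancel hp.ne', Real.rpow_one]
    field_simp
  · intro h
    have h1 := (h.const_mul (1 / Real.pi)).rpow_const (p := 1 / p) (Or.inr (by positivity))
    rwa [mul_zero, Real.zero_rpow (by positivity)] at h1

theorem exists_int_eq_of_tendsto {b : ℕ → ℤ} {c : ℂ}
    (h : Filter.Tendsto (fun n => (b n : ℂ)) Filter.atTop (nhds c)) : ∃ m : ℤ, c = m := by
  have hre : Filter.Tendsto (fun n => ((b n : ℤ) : ℝ)) Filter.atTop (nhds c.re) := by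
    simpa [Function.comp_def] using (continuous_re.tendsto c).comp h
  have him : 0 = c.im := by
    simpa [Function.comp_def] using (continuous_im.tendsto c).comp h
  obtain ⟨m, hm⟩ := Int.isClosedEmbedding_coe_real.isClosed_range.mem_of_tendsto hre
    (Filter.Eventually.of_forall fun n => Set.mem_range_self _)
  exact ⟨m, Complex.ext (by simpa using hm.symm) (by simpa using him.symm)⟩

theorem hasSum_aeval_polynomial (P : Polynomial ℤ) (z : ℂ) :
    HasSum (fun k : ℕ => (P.coeff k : ℂ) * z ^ k) (Polynomial.aeval z P) := by
  rw [Polynomial.aeval_eq_sum_range]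
  simp only [zsmul_eq_mul]
  refine hasSum_sum_of_ne_finset_zero fun k hk => ?_
  rw [Polynomial.coeff_eq_zero_of_natDegree_lt (by simpa [Nat.lt_succ_iff] using hk)]
  simp

theorem theorem4p3 (p : ℝ) (hp : 1 < p) (f : ℂ → ℂ) (hf : MemBergman p f) :
    ((∃ P : ℕ → Polynomial ℤ, (∀ n, (P n).natDegree ≤ n) ∧
        Filter.Tendsto (fun n => bergmanNorm p (fun z => f z - Polynomial.aeval z (P n)))
          Filter.atTop (nhds 0)) ↔
      HasIntegerPowerSeries f) ∧
    (HasIntegerPowerSeries f ↔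
      ∀ k : ℕ, ∃ m : ℤ, iteratedDeriv k f 0 / (k ! : ℂ) = (m : ℂ)) := by
  have hp0 : 0 < p := by linarith
  have hdisk : MeasurableSet unitDisk := measurableSet_ball
  refine ⟨?_, hasIntegerPowerSeries_iff hf.analytic⟩
  -- Nothing is known about `f` outside the disk; its extension by zero is measurable on `ℂ`.
  set g : ℂ → ℂ := unitDisk.indicator f with hg
  have hgf : ∀ z ∈ unitDisk, g z = f z := fun z hz => Set.indicator_of_mem hz f
  have hgm : Measurable g := by
    classical
    rw [hg, ← Set.piecewise_eq_indicator]
    exact hf.analytic.continuousOn.measurable_piecewise continuousOn_const hdisk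
  have hnorm : ∀ Q : ℂ → ℂ, bergmanNorm p (fun z => f z - Q z)
      = bergmanNorm p (fun z => g z - Q z) := by
    intro Q
    rw [bergmanNorm, bergmanNorm]
    congr 2
    exact setIntegral_congr_fun hdisk fun z hz => by simp only [hgf z hz]
  have hgfin : ∫⁻ z in unitDisk, ENNReal.ofReal (‖g z‖ ^ p) ≠ ∞ := by
    rw [setLIntegral_congr_fun hdisk (g := fun z => ENNReal.ofReal (‖f z‖ ^ p))
      fun z hz => by simp only [hgf z hz]]
    exact hf.integrable.lintegral_lt_top.ne
  have hpoly : ∀ P : Polynomial ℤ, Continuous fun z : ℂ => Polynomial.aeval z P :=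
    fun P => P.continuous_aeval
  have hiff : ∀ P : ℕ → Polynomial ℤ,
      (Filter.Tendsto (fun n => bergmanNorm p (fun z => f z - Polynomial.aeval z (P n)))
          Filter.atTop (nhds 0) ↔ Filter.Tendsto (fun n => ∫⁻ z in unitDisk,
            ENNReal.ofReal (‖g z - Polynomial.aeval z (P n)‖ ^ p)) Filter.atTop (nhds 0)) := by
    intro P
    simp only [hnorm]
    refine tendsto_bergmanNorm_iff hp0
      (fun n => (hgm.fun_sub (hpoly (P n)).measurable).aestronglyMeasurable) fun n => ?_
    refine ne_top_of_le_ne_top ?_ (lintegral_norm_sub_rpow_le hp0 hgm)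
    exact ENNReal.mul_ne_top ENNReal.ofReal_ne_top
      (ENNReal.add_ne_top.2 ⟨hgfin, lintegral_continuous_ne_top hp0.le (hpoly (P n))⟩)
  constructor
  · rintro ⟨P, -, hP⟩
    rw [hiff] at hP
    rw [hasIntegerPowerSeries_iff hf.analytic]
    intro m
    obtain ⟨C, hC, h⟩ := exists_coeff_bound hp m
    set c : ℂ := iteratedDeriv m f 0 / (m ! : ℂ) with hc
    have hbound : ∀ n, ENNReal.ofReal (‖c - ((P n).coeff m : ℂ)‖ ^ p) ≤ C * ∫⁻ z in unitDisk,
        ENNReal.ofReal (‖g z - Polynomial.aeval z (P n)‖ ^ p) := fun n =>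
      h _ (fun k => iteratedDeriv k f 0 / (k ! : ℂ) - ((P n).coeff k : ℂ))
        (hgm.fun_sub (hpoly (P n)).measurable) fun z hz => by
          rw [hgf z hz]
          simpa only [sub_mul] using
            (hasSum_taylor_unitDisk hf.analytic z hz).sub (hasSum_aeval_polynomial (P n) z)
    have h1 := ENNReal.Tendsto.const_mul (a := C) hP (Or.inr hC)
    rw [mul_zero] at h1
    have h2 := tendsto_of_tendsto_of_tendsto_of_le_of_le tendsto_const_nhds h1
      (fun _ => zero_le) hbound
    have h3 := (ENNReal.tendsto_toReal ENNReal.zero_ne_top).comp h2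
    have h4 := h3.rpow_const (p := 1 / p) (Or.inr (by positivity))
    rw [ENNReal.toReal_zero, Real.zero_rpow (by positivity)] at h4
    have h5 : Filter.Tendsto (fun n => ‖((P n).coeff m : ℂ) - c‖) Filter.atTop (nhds 0) := by
      refine h4.congr fun n => ?_
      simp only [Function.comp]
      rw [ENNReal.toReal_ofReal (by positivity), ← Real.rpow_mul (norm_nonneg _),
        mul_one_div_cancel hp0.ne', Real.rpow_one, norm_sub_rev]
    exact exists_int_eq_of_tendsto (tendsto_iff_norm_sub_tendsto_zero.2 h5)
  · rintro ⟨a, ha⟩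
    refine ⟨fun n => ∑ k ∈ Finset.range (n + 1), Polynomial.monomial k (a k), fun n => ?_, ?_⟩
    · refine Polynomial.natDegree_sum_le_of_forall_le _ _ fun k hk => ?_
      exact (Polynomial.natDegree_monomial_le _).trans (by simpa [Nat.lt_succ_iff] using hk)
    · rw [hiff]
      have h := (tendsto_lintegral_remainder_disk hp hgm
        (fun z hz => by simpa only [hgf z hz] using ha z hz) hgfin).comp
        (Filter.tendsto_add_atTop_nat 1)
      refine h.congr fun n => ?_
      simp only [Function.comp, map_sum, Polynomial.aeval_monomial]
      rfl
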